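/- For $a=(a_{x,j},a_{z,j})_{j=1}^n\in\mathbb Z_2^{2n}$ let $P_a=\bigotimes_{j=1}^n i^{a_{x,j}a_{z,j}}X^{a_{x,j}}Z^{a_{z,j}}$ be the $n$-qubit Pauli operators. An $n$-qubit Pauli channel is a map $\Lambda(\rho)=\sum_{a\in\mathbb Z_2^{2n}}p_aP_a\rho P_a$ with $(p_a)_a$ a probability distribution; its Pauli eigenvalues are $\lambda_b=\sum_a p_a(-1)^{\langle a,b\rangle}$, where $\langle a,b\rangle=\sum_j(a_{x,j}b_{z,j}+a_{z,j}b_{x,j})\bmod 2$, so that $\Lambda(P_b)=\lambda_bP_b$. A non-adaptive, non-concatenating protocol with a $k$-qubit ancilla and $N$ samples consists of states $\rho_1,\dots,\rho_N$ of $n+k$ qubits and POVMs $\{E^{(1)}_x\}_x,\dots,\{E^{(N)}_x\}_x$ on $n+k$ qubits, all fixed in advance, and of an estimate $\widehat{\boldsymbol\lambda}=(\widehat\lambda_a)_a$ that is a function of the $N$ outcomes. For an unknown Pauli channel $\Lambda$ the $N$ outcomes are independent, and the $i$-th outcome is $x$ with probability $\operatorname{Tr}\bigl(E^{(i)}_x(\Lambda\otimes\mathbb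 1)(\rho_i)\bigr)$. For every $\delta_0<1$ there is a constant $C>0$ that depends only on $\delta_0$ such that for all integers $0\le k\le n$, all $\varepsilon>0$ and all $0<\delta\le\delta_0$ there are an integer $$0\le N\le C\,n\,2^{n-k}\,\varepsilon^{-2}\log\delta^{-1}$$ and a non-adaptive, non-concatenating protocol with a $k$-qubit ancilla and $N$ samples such that, for every $n$-qubit Pauli channel $\Lambda$, $$\Pr\bigl[\,|\widehat\lambda_a-\lambda_a|\le\varepsilon\ \text{ for all } a\in\mathbb Z_2^{2n}\,\bigr]\ \ge\ 1-\delta .$$ -/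

import Mathlib

open scoped ComplexOrder

/-- Labels of the `n`-qubit Pauli operators, that is `ℤ₂^{2n}`: the `j`-th entry of a label `a` is
the pair of bits `(a_{x,j}, a_{z,j})`. -/
abbrev PauliLabel (n : ℕ) : Type := Fin n → ZMod 2 × ZMod 2

/-- Labels of the computational basis of `n` qubits. -/
abbrev Qubits (n : ℕ) : Type := Fin n → Fin 2

/-- The one-qubit operator `i^{xz} X^x Z^z`. -/
noncomputable def pauli1 (c : ZMod 2 × ZMod 2) : Matrix (Fin 2) (Fin 2) ℂ :=
  Complex.I ^ (c.1.val * c.2.val) • (!![0, 1; 1, 0] ^ c.1.val * !![1, 0; 0, -1] ^ c.2.val)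

/-- The tensor product `M 0 ⊗ ⋯ ⊗ M (n-1)` of one-qubit operators, in the computational basis. -/
def tensorQubits {n : ℕ} (M : Fin n → Matrix (Fin 2) (Fin 2) ℂ) :
    Matrix (Qubits n) (Qubits n) ℂ :=
  Matrix.of fun r c => ∏ j, M j (r j) (c j)

/-- The Pauli operator `P_a = ⊗_j i^{a_{x,j} a_{z,j}} X^{a_{x,j}} Z^{a_{z,j}}`. -/
noncomputable def pauliOp {n : ℕ} (a : PauliLabel n) : Matrix (Qubits n) (Qubits n) ℂ :=
  tensorQubits fun j => pauli1 (a j)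

/-- The symplectic inner product `⟨a, b⟩ = ∑_j (a_{x,j} b_{z,j} + a_{z,j} b_{x,j}) mod 2`. -/
def sympl {n : ℕ} (a b : PauliLabel n) : ZMod 2 :=
  ∑ j, ((a j).1 * (b j).2 + (a j).2 * (b j).1)

/-- An `n`-qubit Pauli channel, given by its Pauli error rates, a probability distribution on
`ℤ₂^{2n}`. -/
structure PauliChannel (n : ℕ) where
  rates : PauliLabel n → ℝ
  rates_nonneg : ∀ a, 0 ≤ rates a
  rates_sum : ∑ a, rates a = 1

namespace PauliChannel

/-- The action `ρ ↦ ∑_a p_a P_a ρ P_a` of a Pauli channel. -/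
noncomputable def map {n : ℕ} (L : PauliChannel n) :
    Matrix (Qubits n) (Qubits n) ℂ →ₗ[ℂ] Matrix (Qubits n) (Qubits n) ℂ :=
  ∑ a, (L.rates a : ℂ) •
    (LinearMap.mulRight ℂ (pauliOp a) ∘ₗ LinearMap.mulLeft ℂ (pauliOp a))

/-- The Pauli eigenvalue `λ_b = ∑_a p_a (-1)^{⟨a, b⟩}`; it is the eigenvalue of the channel on the
eigen-operator `P_b`, see `PauliChannel.map_pauliOp`. -/
noncomputable def eigenvalue {n : ℕ} (L : PauliChannel n) (b : PauliLabel n) : ℝ :=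
  ∑ a, L.rates a * (-1) ^ (sympl a b).val

end PauliChannel

theorem tensorQubits_mul {n : ℕ} (M M' : Fin n → Matrix (Fin 2) (Fin 2) ℂ) :
    tensorQubits M * tensorQubits M' = tensorQubits fun j => M j * M' j := by
  ext r c
  simp only [tensorQubits, Matrix.mul_apply, Matrix.of_apply]
  rw [Finset.prod_univ_sum]
  simp [Finset.prod_mul_distrib]

theorem neg_one_pow_val_eq (x : ZMod 2) : (-1 : ℂ) ^ x.val = if x = 0 then 1 else -1 := by
  have h : x = 0 ∨ x = 1 := by revert x; decide
  rcases h with rfl | rfl <;> simp [ZMod.val_one]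

theorem neg_one_pow_val_add (x y : ZMod 2) :
    (-1 : ℂ) ^ (x + y).val = (-1) ^ x.val * (-1) ^ y.val := by
  have h : ∀ x : ZMod 2, x = 0 ∨ x = 1 := by decide
  rcases h x with rfl | rfl <;> rcases h y with rfl | rfl <;>
    simp [neg_one_pow_val_eq, show (1 : ZMod 2) + 1 = 0 from rfl]

theorem neg_one_pow_val_sum {ι : Type*} (s : Finset ι) (f : ι → ZMod 2) :
    (-1 : ℂ) ^ (∑ j ∈ s, f j).val = ∏ j ∈ s, (-1) ^ (f j).val := by
  classical
  induction s using Finset.induction_on with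
  | empty => simp
  | insert i s hi ih => rw [Finset.sum_insert hi, Finset.prod_insert hi, neg_one_pow_val_add, ih]

theorem pauli1_conj (c d : ZMod 2 × ZMod 2) :
    pauli1 c * pauli1 d * pauli1 c = (-1 : ℂ) ^ (c.1 * d.2 + c.2 * d.1).val • pauli1 d := by
  obtain ⟨x, z⟩ := c
  obtain ⟨x', z'⟩ := d
  have h : ∀ x : ZMod 2, x = 0 ∨ x = 1 := by decide
  rw [neg_one_pow_val_eq]
  rcases h x with rfl | rfl <;> rcases h z with rfl | rfl <;>
    rcases h x' with rfl | rfl <;> rcases h z' with rfl | rfl <;>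
    · ext i j
      fin_cases i <;> fin_cases j <;>
        simp [pauli1, ZMod.val_one, show (1 : ZMod 2) + 1 = 0 from rfl, Matrix.mul_apply]

theorem pauliOp_conj {n : ℕ} (a b : PauliLabel n) :
    pauliOp a * pauliOp b * pauliOp a = (-1 : ℂ) ^ (sympl a b).val • pauliOp b := by
  simp only [pauliOp, tensorQubits_mul, pauli1_conj, sympl, neg_one_pow_val_sum]
  ext r c
  simp [tensorQubits, Finset.prod_mul_distrib]

/-- `P_b` is an eigen-operator of every Pauli channel, with eigenvalue `λ_b`. -/
theorem PauliChannel.map_pauliOp {n : ℕ} (L : PauliChannel n) (b : PauliLabel n) :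
    L.map (pauliOp b) = (L.eigenvalue b : ℂ) • pauliOp b := by
  simp [PauliChannel.map, PauliChannel.eigenvalue, pauliOp_conj, Finset.sum_smul, mul_smul]

/-- The map `Φ ⊗ 𝟙` on operators on `A ⊗ B`: the map `Φ` acts on the factor `A`, the factor `B`
is left alone. -/
def applyLeft {A B : Type*} (Φ : Matrix A A ℂ →ₗ[ℂ] Matrix A A ℂ)
    (ρ : Matrix (A × B) (A × B) ℂ) : Matrix (A × B) (A × B) ℂ :=
  Matrix.of fun r c => Φ (Matrix.of fun i j => ρ (i, r.2) (j, c.2)) r.1 c.1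

/-- A non-adaptive, non-concatenating Pauli channel estimation protocol with a `k`-qubit ancilla
and `N` samples of the unknown `n`-qubit channel. For the `i`-th sample, a state of `n + k` qubits
is prepared, its first `n` qubits are sent once through the channel, and all `n + k` qubits are
measured by a POVM. The states and the POVMs are fixed in advance. The estimate of the Pauli
eigenvalues is a function of the `N` outcomes. -/
structure AncillaProtocol (n k N : ℕ) where
  /-- the input states -/
  state : Fin N → Matrix (Qubits n × Qubits k) (Qubits n × Qubits k) ℂ
  state_posSemidef : ∀ i, (state i).PosSemidef
  state_trace : ∀ i, (state i).trace = 1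
  /-- the possible outcomes of the measurements -/
  Outcome : Fin N → Type
  outcomeFintype : ∀ i, Fintype (Outcome i)
  /-- the POVMs -/
  effect : ∀ i, Outcome i → Matrix (Qubits n × Qubits k) (Qubits n × Qubits k) ℂ
  effect_posSemidef : ∀ i x, (effect i x).PosSemidef
  effect_sum : ∀ i, ∑ x, effect i x = 1
  /-- the estimate computed from the outcomes -/
  estimate : (∀ i, Outcome i) → PauliLabel n → ℝ

attribute [instance] AncillaProtocol.outcomeFintype

namespace AncillaProtocol

/-- The probability `Tr(E_x (Λ ⊗ 𝟙)(ρ_i))` of the outcome `x` in the `i`-th measurement. -/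
noncomputable def outcomeProb {n k N : ℕ} (P : AncillaProtocol n k N) (L : PauliChannel n)
    (i : Fin N) (x : P.Outcome i) : ℝ :=
  (P.effect i x * applyLeft L.map (P.state i)).trace.re

open Classical in
/-- The probability that `|λ̂_a - λ_a| ≤ ε` holds for all `a`. The `N` measurements are
independent. -/
noncomputable def successProb {n k N : ℕ} (P : AncillaProtocol n k N) (L : PauliChannel n)
    (ε : ℝ) : ℝ :=
  ∑ o : (∀ i, P.Outcome i) with ∀ a, |P.estimate o a - L.eigenvalue a| ≤ ε,
    ∏ i, P.outcomeProb L i (o i)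

end AncillaProtocol

open Matrix

open scoped Kronecker

/-! Suppose a probe state `ρ` is fixed on both sides by `P_b ⊗ Q`, with `Q` acting on the ancilla.
The errors `P_a` and `P_c` send `ρ` to orthogonal states whenever exactly one of them commutes with
`P_b`. If moreover the ancilla marginal of `ρ` is maximally mixed, the Pauli twirl shows that the
operators `P_c ρ P_c`, scaled by `2^k / 2^n`, form a POVM. Its outcome `c` may differ from the true
error `a`, but never in `⟨c, b⟩`, so `(-1)^⟨c, b⟩` is an unbiased estimate of `λ_b` with values
`±1`, for all `b` stabilizing this probe at once (`sum_neg_one_pow_mul_trace_errorEffect`).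

It remains to cover all labels by few probes (`exists_probe_cover`). Let `n = k + m`. Sharing `k`
Bell pairs between the first `k` qubits and the ancilla deals with every Pauli operator on these
qubits. On the other `m` qubits, `ℤ₂^{2m}` is covered by the `2^m + 1` subspaces `{x = 0}` and `{z =
A_s x}`, where `A_s` is the matrix of the form `Tr (s u v)` on the field with `2^m` elements. Each
subspace has a common eigenvector.

With `M` samples of each probe, a Chernoff bound (`sum_prod_le_two_mul_exp`) and a union bound over
`4^n` labels make `M` of order `ε⁻² (n + log δ⁻¹)` sufficient. As `log δ⁻¹` is bounded below in
terms of `δ₀`, the sum is at most a constant times `n log δ⁻¹`. -/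

/-! ### Algebra of Pauli operators -/

theorem pauli1_mul_self (c : ZMod 2 × ZMod 2) : pauli1 c * pauli1 c = 1 := by
  obtain ⟨x, z⟩ := c
  have h : ∀ x : ZMod 2, x = 0 ∨ x = 1 := by decide
  rcases h x with rfl | rfl <;> rcases h z with rfl | rfl <;>
    · ext i j
      fin_cases i <;> fin_cases j <;> simp [pauli1, ZMod.val_one, Matrix.mul_apply]

theorem star_pauli1_apply (c : ZMod 2 × ZMod 2) (i j : Fin 2) :
    star (pauli1 c j i) = pauli1 c i j := by
  obtain ⟨x, z⟩ := c
  have h : ∀ x : ZMod 2, x = 0 ∨ x = 1 := by decide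
  rcases h x with rfl | rfl <;> rcases h z with rfl | rfl <;>
    fin_cases i <;> fin_cases j <;> simp [pauli1, ZMod.val_one]

theorem sum_pauli1_mul_pauli1 (i r s j : Fin 2) :
    ∑ c, pauli1 c i r * pauli1 c s j = if i = j ∧ r = s then 2 else 0 := by
  have hu : (Finset.univ : Finset (ZMod 2)) = {0, 1} := rfl
  rw [Fintype.sum_prod_type]
  fin_cases i <;> fin_cases r <;> fin_cases s <;> fin_cases j <;>
    simp [pauli1, ZMod.val_one, Matrix.mul_apply, hu] <;> norm_num

/-- The bit that labels a basis state of a qubit, as an element of `ZMod 2`. -/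
def bit (i : Fin 2) : ZMod 2 := i

/-- The entries of a one-qubit Pauli operator are a phase times those of `X^x Z^z`. -/
theorem pauli1_apply (c : ZMod 2 × ZMod 2) (i j : Fin 2) :
    pauli1 c i j = if bit i = bit j + c.1 then
      Complex.I ^ (c.1.val * c.2.val) * (-1) ^ (c.2 * bit j).val else 0 := by
  obtain ⟨x, z⟩ := c
  have h : ∀ x : ZMod 2, x = 0 ∨ x = 1 := by decide
  have h0 : bit 0 = 0 := rfl
  have h1 : bit 1 = 1 := rfl
  rcases h x with rfl | rfl <;> rcases h z with rfl | rfl <;>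
    fin_cases i <;> fin_cases j <;>
      simp [pauli1, ZMod.val_one, h0, h1, show (1 : ZMod 2) + 1 = 0 from rfl]

section PauliOp

variable {n : ℕ}

theorem pauliOp_mul_self (a : PauliLabel n) : pauliOp a * pauliOp a = 1 := by
  rw [pauliOp, tensorQubits_mul]
  ext r c
  simp [tensorQubits, pauli1_mul_self, Matrix.one_apply, Finset.prod_ite_zero, funext_iff]

theorem pauliOp_isHermitian (a : PauliLabel n) : (pauliOp a).IsHermitian := by
  ext r c
  simp only [Matrix.conjTranspose_apply, pauliOp, tensorQubits, Matrix.of_apply, star_prod,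
    star_pauli1_apply]

theorem neg_one_pow_val_mul_self (x : ZMod 2) : (-1 : ℂ) ^ x.val * (-1) ^ x.val = 1 := by
  rw [← neg_one_pow_val_add, CharTwo.add_self_eq_zero]; simp

theorem pauliOp_mul_comm (a b : PauliLabel n) :
    pauliOp a * pauliOp b = (-1 : ℂ) ^ (sympl a b).val • (pauliOp b * pauliOp a) := by
  have h := congrArg (· * pauliOp a) (pauliOp_conj a b)
  simpa only [mul_assoc, pauliOp_mul_self, mul_one, Matrix.smul_mul] using h

/-- The entries of `∑ P_c ⊗ P_c = 2^n • SWAP`, from which the twirl follows. -/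
theorem sum_pauliOp_mul_pauliOp (i r s j : Qubits n) :
    ∑ c : PauliLabel n, pauliOp c i r * pauliOp c s j = if i = j ∧ r = s then 2 ^ n else 0 := by
  simp only [pauliOp, tensorQubits, Matrix.of_apply, ← Finset.prod_mul_distrib]
  rw [← Fintype.piFinset_univ, ← Finset.prod_univ_sum (fun _ => Finset.univ)
    (fun q c => pauli1 c (i q) (r q) * pauli1 c (s q) (j q))]
  simp only [sum_pauli1_mul_pauli1, Finset.prod_ite_zero, Finset.mem_univ, forall_and]
  simp [funext_iff]

/-- The Pauli twirl of an operator is a multiple of the identity. -/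
theorem sum_pauliOp_conj (X : Matrix (Qubits n) (Qubits n) ℂ) (i j : Qubits n) :
    ∑ c : PauliLabel n, (pauliOp c * X * pauliOp c : Matrix _ _ ℂ) i j =
      if i = j then 2 ^ n * X.trace else 0 := by
  simp only [Matrix.mul_apply, Finset.sum_mul]
  rw [Finset.sum_comm]
  simp_rw [Finset.sum_comm (s := (Finset.univ : Finset (PauliLabel n)))]
  have h (s r : Qubits n) : ∑ c, pauliOp c i r * X r s * pauliOp c s j =
      (if i = j ∧ r = s then 2 ^ n else 0) * X r s := by
    rw [← sum_pauliOp_mul_pauliOp, Finset.sum_mul]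
    exact Finset.sum_congr rfl fun _ _ => by ring
  simp_rw [h]
  by_cases hij : i = j <;> simp [hij, Matrix.trace, Finset.mul_sum]

end PauliOp

/-! ### Covering the Pauli operators by stabilizer states -/

/-- A family of `2 ^ m` symmetric matrices over `ℤ₂` of which, for every `x ≠ 0`, one maps `x` to
any prescribed vector. The matrices are those of the forms `(u, v) ↦ Tr (s u v)` on the field with
`2 ^ m` elements. -/
theorem exists_transitive_symmetric_family (m : ℕ) :
    ∃ (S : Type) (_ : Fintype S) (A : S → Matrix (Fin m) (Fin m) (ZMod 2)),
      Fintype.card S = 2 ^ m ∧ (∀ s, (A s).IsSymm) ∧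
        ∀ x, x ≠ 0 → ∀ z, ∃ s, A s *ᵥ x = z := by
  rcases eq_or_ne m 0 with rfl | hm
  · exact ⟨Unit, inferInstance, fun _ => 0, by simp, fun _ => rfl,
      fun x hx => absurd (Subsingleton.elim x 0) hx⟩
  have : Fact (Nat.Prime 2) := ⟨Nat.prime_two⟩
  let K := GaloisField 2 m
  have hfin : Module.finrank (ZMod 2) K = m := GaloisField.finrank 2 hm
  let b : Module.Basis (Fin m) (ZMod 2) K := Module.finBasisOfFinrankEq (ZMod 2) K hfin
  have : Finite K := Module.finite_of_finite (ZMod 2)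
  let instK : Fintype K := Fintype.ofFinite K
  let A : K → Matrix (Fin m) (Fin m) (ZMod 2) := fun s =>
    of fun i j => Algebra.trace (ZMod 2) K (s * (b i * b j))
  have hA (s : K) (x : Fin m → ZMod 2) (i : Fin m) :
      (A s *ᵥ x) i = Algebra.trace (ZMod 2) K (s * (∑ j, x j • b j) * b i) := by
    rw [Finset.mul_sum, Finset.sum_mul, map_sum]
    change ∑ j, Algebra.trace (ZMod 2) K (s * (b i * b j)) * x j = _
    refine Finset.sum_congr rfl fun j _ => ?_
    rw [mul_smul_comm, smul_mul_assoc, map_smul, smul_eq_mul, mul_comm]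
    congr 2
    ring
  refine ⟨K, instK, A, ?_, fun s => ?_, fun x hx z => ?_⟩
  · rw [← Nat.card_eq_fintype_card]; exact GaloisField.card 2 m hm
  · ext i j
    simp [A, mul_comm (b i)]
  · let T : K →ₗ[ZMod 2] (Fin m → ZMod 2) :=
      { toFun := fun s => A s *ᵥ x
        map_add' := fun s t => by ext i; simp only [hA, Pi.add_apply, add_mul, map_add]
        map_smul' := fun c s => by
          ext i
          simp only [hA, Pi.smul_apply, smul_mul_assoc, map_smul, RingHom.id_apply] }
    have hx' : ∑ j, x j • b j ≠ 0 := fun h => hx <| funext fun j =>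
      Fintype.linearIndependent_iff.mp b.linearIndependent x h j
    -- If `A s *ᵥ x = 0`, then `s` times the field element with coordinates `x` is orthogonal to a
    -- basis for the trace form, hence zero. Surjectivity follows by equality of dimensions.
    have hT : Function.Injective T := by
      rw [← LinearMap.ker_eq_bot, LinearMap.ker_eq_bot']
      intro s hs
      have h0 : s * (∑ j, x j • b j) = 0 := by
        refine (traceForm_nondegenerate (ZMod 2) K).1 _ fun y => ?_
        have : Algebra.traceForm (ZMod 2) K (s * (∑ j, x j • b j)) = 0 :=
          b.ext fun i => by
            rw [Algebra.traceForm_apply, ← hA]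
            exact congrFun hs i
        rw [this, LinearMap.zero_apply]
      exact (mul_eq_zero.mp h0).resolve_right hx'
    have hd : Module.finrank (ZMod 2) K = Module.finrank (ZMod 2) (Fin m → ZMod 2) := by
      rw [hfin, Module.finrank_fin_fun]
    exact (LinearMap.injective_iff_surjective_of_finrank_eq_finrank hd).mp hT z

theorem neg_one_pow_intCast_val (t : ℤ) : (-1 : ℂ) ^ (t : ZMod 2).val = (-1) ^ t := by
  rw [neg_one_pow_val_eq]
  rcases Int.even_or_odd t with h | h
  · rw [if_pos ((ZMod.intCast_eq_zero_iff_even).mpr h), h.neg_one_zpow]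
  · rw [if_neg (by rwa [ZMod.intCast_eq_zero_iff_even, Int.not_even_iff_odd]), h.neg_one_zpow]

theorem val_add_zmod_two (x y : ZMod 2) :
    ((x + y).val : ℤ) = x.val + y.val - 2 * (x.val * y.val) := by
  revert x y; decide

/-- Every symmetric bilinear form over `ℤ₂` is the polar form of a quadratic phase, whose values are
fourth roots of unity. -/
theorem exists_quadratic_phase {m : ℕ} (A : Matrix (Fin m) (Fin m) (ZMod 2)) (hA : A.IsSymm) :
    ∃ χ : (Fin m → ZMod 2) → ℂ, χ 0 = 1 ∧
      ∀ r x, χ (r + x) = χ r * χ x * (-1) ^ (r ⬝ᵥ A *ᵥ x).val := by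
  let lift : (Fin m → ZMod 2) → Fin m → ℤ := fun c i => (c i).val
  let A' : Matrix (Fin m) (Fin m) ℤ := of fun i j => ((A i j).val : ℤ)
  have hsymm (u v : Fin m → ℤ) : u ⬝ᵥ A' *ᵥ v = v ⬝ᵥ A' *ᵥ u := by
    have ht : A'ᵀ = A' := by
      ext i j; simp only [A', transpose_apply, of_apply, hA.apply]
    rw [dotProduct_mulVec, dotProduct_comm, ← mulVec_transpose, ht]
  have hcast (r x : Fin m → ZMod 2) :
      ((lift r ⬝ᵥ A' *ᵥ lift x : ℤ) : ZMod 2) = r ⬝ᵥ A *ᵥ x := by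
    simp [dotProduct, mulVec, lift, A']
  -- The form is evaluated on lifts of the bits to the integers 0 and 1. The cross term occurs
  -- twice, and `I ^ 2 = -1` gives the sign; the carry `2 • u` of addition mod 2 changes the
  -- exponent only by multiples of 4.
  refine ⟨fun c => Complex.I ^ (lift c ⬝ᵥ A' *ᵥ lift c), by simp [lift, dotProduct],
    fun r x => ?_⟩
  let u : Fin m → ℤ := fun i => (r i).val * (x i).val
  have hl : lift (r + x) = lift r + lift x - (2 : ℤ) • u := by
    exact funext fun i => val_add_zmod_two (r i) (x i)
  have hq : lift (r + x) ⬝ᵥ A' *ᵥ lift (r + x) =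
      lift r ⬝ᵥ A' *ᵥ lift r + lift x ⬝ᵥ A' *ᵥ lift x + 2 * (lift r ⬝ᵥ A' *ᵥ lift x) +
        4 * (u ⬝ᵥ A' *ᵥ u - u ⬝ᵥ A' *ᵥ lift r - u ⬝ᵥ A' *ᵥ lift x) := by
    rw [hl]
    simp only [mulVec_sub, mulVec_add, mulVec_smul, dotProduct_sub, dotProduct_add,
      sub_dotProduct, add_dotProduct, dotProduct_smul, smul_dotProduct, smul_eq_mul]
    rw [hsymm (lift x) (lift r), hsymm (lift r) u, hsymm (lift x) u]
    ring
  have h4 : Complex.I ^ (4 : ℤ) = 1 := by exact_mod_cast Complex.I_pow_four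
  have h2 : Complex.I ^ (2 : ℤ) = -1 := by exact_mod_cast Complex.I_sq
  simp only [hq, zpow_add₀ Complex.I_ne_zero, _root_.zpow_mul, h4, h2, _root_.one_zpow, mul_one,
    ← neg_one_pow_intCast_val, hcast]

/-- Pauli operators permute the computational basis up to phases. -/
theorem pauliOp_mulVec {m : ℕ} (b : PauliLabel m) (φ : (Fin m → ZMod 2) → ℂ) (r : Qubits m) :
    (pauliOp b *ᵥ fun c : Qubits m => φ (fun i => bit (c i))) r =
      (∏ i, Complex.I ^ ((b i).1.val * (b i).2.val)) *
        ((-1) ^ ((fun i => (b i).2) ⬝ᵥ ((fun i => bit (r i)) + fun i => (b i).1)).val *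
          φ ((fun i => bit (r i)) + fun i => (b i).1)) := by
  let t : Qubits m := fun i => bit (r i) + (b i).1
  have ht : (fun i => bit (t i)) = (fun i => bit (r i)) + fun i => (b i).1 := rfl
  rw [← ht, mulVec, dotProduct, Finset.sum_eq_single t, ← mul_assoc]
  · congr 1
    have hone (i : Fin m) : bit (r i) = bit (t i) + (b i).1 := by
      have : bit (t i) = bit (r i) + (b i).1 := rfl
      rw [this, add_assoc, CharTwo.add_self_eq_zero, add_zero]
    simp only [pauliOp, tensorQubits, of_apply, pauli1_apply, ← hone, if_true,
      Finset.prod_mul_distrib, dotProduct, neg_one_pow_val_sum]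
  · intro c _ hc
    obtain ⟨i, hi⟩ := Function.ne_iff.mp hc
    have h0 : pauliOp b r c = 0 := by
      refine Finset.prod_eq_zero (Finset.mem_univ i) ?_
      change pauli1 (b i) (r i) (c i) = 0
      rw [pauli1_apply, if_neg]
      intro h
      refine hi ?_
      change bit (c i) = bit (r i) + (b i).1
      rw [h, add_assoc, CharTwo.add_self_eq_zero, add_zero]
    rw [h0, zero_mul]
  · simp

theorem exists_smul_dotProduct_star_eq_one {ι : Type*} [Fintype ι] (φ : ι → ℂ) (hφ : φ ≠ 0) :
    ∃ c : ℂ, (c • φ) ⬝ᵥ star (c • φ) = 1 := by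
  have hpos : 0 < ∑ i, Complex.normSq (φ i) := by
    obtain ⟨i, hi⟩ := Function.ne_iff.mp hφ
    exact Finset.sum_pos' (fun _ _ => Complex.normSq_nonneg _)
      ⟨i, Finset.mem_univ i, Complex.normSq_pos.mpr hi⟩
  have hs : φ ⬝ᵥ star φ = ((∑ i, Complex.normSq (φ i) : ℝ) : ℂ) := by
    simp [dotProduct, Complex.mul_conj]
  refine ⟨((Real.sqrt (∑ i, Complex.normSq (φ i)))⁻¹ : ℝ), ?_⟩
  rw [star_smul, smul_dotProduct, dotProduct_smul, hs, Complex.star_def, Complex.conj_ofReal,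
    smul_eq_mul, smul_eq_mul, ← mul_assoc]
  norm_cast
  rw [← mul_inv, Real.mul_self_sqrt hpos.le, inv_mul_cancel₀ hpos.ne']

/-- There are `2 ^ m + 1` stabilizer states such that every Pauli operator stabilizes one of
them up to a phase. -/
theorem exists_stabilizer_cover (m : ℕ) :
    ∃ (S : Type) (_ : Fintype S) (φ : S → Qubits m → ℂ), Fintype.card S = 2 ^ m + 1 ∧
      (∀ s, φ s ⬝ᵥ star (φ s) = 1) ∧ ∀ b, ∃ s, ∃ ω : ℂ, pauliOp b *ᵥ φ s = ω • φ s := by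
  obtain ⟨S, _, A, hcard, hA, hcover⟩ := exists_transitive_symmetric_family m
  choose χ hχ0 hχ using fun s => exists_quadratic_phase (A s) (hA s)
  -- `none` is the basis state 0, for labels without `X` part; `some s` serves the labels with `z =
  -- A s *ᵥ x`.
  let f : Option S → (Fin m → ZMod 2) → ℂ := fun s => s.elim (Pi.single 0 1) χ
  let φ : Option S → Qubits m → ℂ := fun s c => f s fun i => bit (c i)
  have hφ (s : Option S) : φ s ≠ 0 := by
    refine Function.ne_iff.mpr ⟨0, ?_⟩
    have h0 : (fun i => bit ((0 : Qubits m) i)) = 0 := rfl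
    change f s (fun i => bit ((0 : Qubits m) i)) ≠ 0
    rw [h0]
    cases s with
    | none => simp [f]
    | some s => exact (hχ0 s).trans_ne one_ne_zero
  choose κ hκ using fun s => exists_smul_dotProduct_star_eq_one (φ s) (hφ s)
  refine ⟨Option S, inferInstance, fun s => κ s • φ s, by simp [hcard], hκ, fun b => ?_⟩
  suffices h : ∃ s, ∃ ω : ℂ, pauliOp b *ᵥ φ s = ω • φ s by
    obtain ⟨s, ω, h⟩ := h
    exact ⟨s, ω, by rw [mulVec_smul, h, smul_comm]⟩
  by_cases hx : (fun i => (b i).1) = 0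
  · refine ⟨none, ∏ i, Complex.I ^ ((b i).1.val * (b i).2.val), funext fun r => ?_⟩
    rw [pauliOp_mulVec b (f none) r, hx, add_zero, Pi.smul_apply, smul_eq_mul]
    congr 1
    change _ = f none _
    by_cases hr : (fun i => bit (r i)) = 0
    · simp [hr]
    · simp [f, Pi.single_eq_of_ne hr]
  · obtain ⟨s, hs⟩ := hcover _ hx fun i => (b i).2
    refine ⟨some s, (∏ i, Complex.I ^ ((b i).1.val * (b i).2.val)) *
      ((-1) ^ ((fun i => (b i).2) ⬝ᵥ fun i => (b i).1).val * χ s fun i => (b i).1),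
      funext fun r => ?_⟩
    rw [pauliOp_mulVec b (f (some s)) r, Pi.smul_apply, smul_eq_mul, mul_assoc]
    congr 1
    change _ * χ s _ = _ * χ s _
    -- The sign `(-1)^(z · r)` from the `Z` part cancels the one from the polar form of `χ s`,
    -- because `A s *ᵥ x = z`.
    rw [hχ, hs, dotProduct_add, neg_one_pow_val_add,
      dotProduct_comm (fun i => bit (r i)) fun i => (b i).2]
    linear_combination ((-1) ^ ((fun i => (b i).2) ⬝ᵥ fun i => (b i).1).val *
      χ s (fun i => bit (r i)) * χ s fun i => (b i).1) *
        neg_one_pow_val_mul_self ((fun i => (b i).2) ⬝ᵥ fun i => bit (r i))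

/-! ### Measuring the Pauli error on a probe state -/

section Probe

variable {n k : ℕ}

/-- The Pauli operator `P_a` on the `n` qubits that pass through the channel, times the identity
on the ancilla. -/
noncomputable def localPauli (k : ℕ) (a : PauliLabel n) :
    Matrix (Qubits n × Qubits k) (Qubits n × Qubits k) ℂ :=
  pauliOp a ⊗ₖ 1

theorem localPauli_mul_self (a : PauliLabel n) : localPauli k a * localPauli k a = 1 := by
  rw [localPauli, ← mul_kronecker_mul, pauliOp_mul_self, mul_one, one_kronecker_one]

theorem localPauli_isHermitian (a : PauliLabel n) : (localPauli k a).IsHermitian := by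
  rw [localPauli, IsHermitian, conjTranspose_kronecker, (pauliOp_isHermitian a).eq,
    conjTranspose_one]

theorem localPauli_conj_apply (a : PauliLabel n)
    (ρ : Matrix (Qubits n × Qubits k) (Qubits n × Qubits k) ℂ) (i j : Qubits n × Qubits k) :
    (localPauli k a * ρ * localPauli k a) i j =
      (pauliOp a * (of fun r s => ρ (r, i.2) (s, j.2)) * pauliOp a : Matrix _ _ ℂ) i.1 j.1 := by
  simp [localPauli, mul_apply, Fintype.sum_prod_type, one_apply]

/-- The Kraus form reduces statements about the channel to a single Pauli error. -/
theorem applyLeft_map_eq_sum (L : PauliChannel n)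
    (ρ : Matrix (Qubits n × Qubits k) (Qubits n × Qubits k) ℂ) :
    applyLeft L.map ρ = ∑ a, (L.rates a : ℂ) • (localPauli k a * ρ * localPauli k a) := by
  ext i j
  simp only [applyLeft, of_apply, PauliChannel.map, LinearMap.sum_apply, LinearMap.smul_apply,
    LinearMap.comp_apply, LinearMap.mulLeft_apply, LinearMap.mulRight_apply, Matrix.sum_apply,
    Matrix.smul_apply, localPauli_conj_apply]

theorem localPauli_conj_posSemidef (a : PauliLabel n)
    {ρ : Matrix (Qubits n × Qubits k) (Qubits n × Qubits k) ℂ} (hρ : ρ.PosSemidef) :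
    (localPauli k a * ρ * localPauli k a).PosSemidef := by
  simpa only [(localPauli_isHermitian a).eq] using hρ.mul_mul_conjTranspose_same (localPauli k a)

theorem trace_localPauli_conj (a : PauliLabel n)
    (ρ : Matrix (Qubits n × Qubits k) (Qubits n × Qubits k) ℂ) :
    (localPauli k a * ρ * localPauli k a).trace = ρ.trace := by
  rw [trace_mul_comm, ← mul_assoc, localPauli_mul_self, one_mul]

theorem applyLeft_map_posSemidef (L : PauliChannel n)
    {ρ : Matrix (Qubits n × Qubits k) (Qubits n × Qubits k) ℂ} (hρ : ρ.PosSemidef) :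
    (applyLeft L.map ρ).PosSemidef := by
  rw [applyLeft_map_eq_sum]
  exact posSemidef_sum _ fun a _ => (localPauli_conj_posSemidef a hρ).smul
    (by exact_mod_cast L.rates_nonneg a)

theorem trace_applyLeft_map (L : PauliChannel n)
    (ρ : Matrix (Qubits n × Qubits k) (Qubits n × Qubits k) ℂ) :
    (applyLeft L.map ρ).trace = ρ.trace := by
  simp only [applyLeft_map_eq_sum, trace_sum, trace_smul, trace_localPauli_conj, smul_eq_mul,
    ← Finset.sum_mul]
  rw [← Complex.ofReal_sum, L.rates_sum, Complex.ofReal_one, one_mul]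

/-- The reduced state of the ancilla is maximally mixed. -/
def HasMixedAncilla (ρ : Matrix (Qubits n × Qubits k) (Qubits n × Qubits k) ℂ) : Prop :=
  ∀ y y', ∑ x, ρ (x, y) (x, y') = if y = y' then ((2 : ℂ) ^ k)⁻¹ else 0

theorem HasMixedAncilla.trace_eq_one
    {ρ : Matrix (Qubits n × Qubits k) (Qubits n × Qubits k) ℂ} (h : HasMixedAncilla ρ) :
    ρ.trace = 1 := by
  rw [trace, Fintype.sum_prod_type, Finset.sum_comm]
  simp [h _ _]

/-- The measurement whose outcome is the Pauli error that hits the state `ρ`, as far as it can be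
identified. -/
noncomputable def errorEffect (ρ : Matrix (Qubits n × Qubits k) (Qubits n × Qubits k) ℂ)
    (c : PauliLabel n) : Matrix (Qubits n × Qubits k) (Qubits n × Qubits k) ℂ :=
  ((2 : ℂ) ^ k / 2 ^ n) • (localPauli k c * ρ * localPauli k c)

theorem errorEffect_posSemidef {ρ : Matrix (Qubits n × Qubits k) (Qubits n × Qubits k) ℂ}
    (hρ : ρ.PosSemidef) (c : PauliLabel n) : (errorEffect ρ c).PosSemidef := by
  refine (localPauli_conj_posSemidef c hρ).smul ?_
  have h : (0 : ℝ) ≤ 2 ^ k / 2 ^ n := by positivity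
  have h' := Complex.zero_le_real.mpr h
  push_cast at h'
  exact h'

/-- Twirling the first `n` qubits leaves `2^n` times the identity tensor the ancilla marginal; the
prefactor of `errorEffect` is chosen to normalize this. -/
theorem HasMixedAncilla.sum_errorEffect
    {ρ : Matrix (Qubits n × Qubits k) (Qubits n × Qubits k) ℂ} (h : HasMixedAncilla ρ) :
    ∑ c, errorEffect ρ c = 1 := by
  ext ⟨i, y⟩ ⟨j, y'⟩
  simp only [errorEffect, Matrix.sum_apply, Matrix.smul_apply, localPauli_conj_apply, smul_eq_mul,
    ← Finset.mul_sum, sum_pauliOp_conj]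
  have ht : (of fun r s => ρ (r, y) (s, y')).trace = if y = y' then ((2 : ℂ) ^ k)⁻¹ else 0 :=
    h y y'
  rw [ht, one_apply]
  by_cases hi : i = j <;> by_cases hy : y = y' <;> simp [hi, hy]
  field_simp

open scoped MatrixOrder in
theorem trace_mul_nonneg_of_posSemidef {ι : Type*} [Fintype ι] {A B : Matrix ι ι ℂ}
    (hA : A.PosSemidef) (hB : B.PosSemidef) : 0 ≤ (A * B).trace := by
  classical
  obtain ⟨C, rfl⟩ := CStarAlgebra.nonneg_iff_eq_star_mul_self.mp hA.nonneg
  rw [star_eq_conjTranspose]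
  rw [mul_assoc, trace_mul_comm]
  exact (hB.mul_mul_conjTranspose_same C).trace_nonneg

theorem localPauli_mul_kronecker (a b : PauliLabel n) (Q : Matrix (Qubits k) (Qubits k) ℂ) :
    localPauli k a * (pauliOp b ⊗ₖ Q) =
      (-1 : ℂ) ^ (sympl a b).val • (pauliOp b ⊗ₖ Q * localPauli k a) := by
  rw [localPauli, ← mul_kronecker_mul, ← mul_kronecker_mul, one_mul, mul_one, pauliOp_mul_comm,
    smul_kronecker]

/-- If `ρ` is stabilized by `P_b ⊗ Q`, then two Pauli errors between which `ρ` does not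
discriminate perfectly agree in their commutation with `P_b`. -/
theorem neg_one_pow_sympl_mul_trace
    {ρ : Matrix (Qubits n × Qubits k) (Qubits n × Qubits k) ℂ} {b : PauliLabel n}
    {Q : Matrix (Qubits k) (Qubits k) ℂ} (hl : pauliOp b ⊗ₖ Q * ρ = ρ)
    (hr : ρ * pauliOp b ⊗ₖ Q = ρ) (a c : PauliLabel n) :
    (-1 : ℂ) ^ (sympl c b).val *
        (localPauli k c * ρ * localPauli k c * (localPauli k a * ρ * localPauli k a)).trace =
      (-1 : ℂ) ^ (sympl a b).val *
        (localPauli k c * ρ * localPauli k c * (localPauli k a * ρ * localPauli k a)).trace := by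
  set S := pauliOp b ⊗ₖ Q
  set X := (localPauli k c * ρ * localPauli k c * (localPauli k a * ρ * localPauli k a)).trace
    with hX
  -- The stabilizer is inserted next to one copy of `ρ`, moved past `P_a P_c` at the cost of the
  -- sign, and absorbed by the other copy under the cyclic trace.
  have h : X = (-1 : ℂ) ^ (sympl a b).val * (-1) ^ (sympl c b).val * X := by
    have h1 : X = (localPauli k a * localPauli k c * ρ *
        (localPauli k c * localPauli k a) * ρ).trace := by
      rw [hX, ← mul_assoc, trace_mul_comm]
      simp only [mul_assoc]
    have h2 : localPauli k a * localPauli k c * S =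
        ((-1 : ℂ) ^ (sympl a b).val * (-1) ^ (sympl c b).val) •
          (S * (localPauli k a * localPauli k c)) := by
      rw [mul_assoc, localPauli_mul_kronecker, mul_smul_comm, ← mul_assoc,
        localPauli_mul_kronecker, smul_mul_assoc, smul_smul, mul_assoc, mul_comm (_ ^ _)]
    calc X = (localPauli k a * localPauli k c * S * ρ *
          (localPauli k c * localPauli k a) * ρ).trace := by
            rw [h1, mul_assoc (localPauli k a * localPauli k c) S, hl]
      _ = (-1 : ℂ) ^ (sympl a b).val * (-1) ^ (sympl c b).val *
          (S * (localPauli k a * localPauli k c * ρ *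
            (localPauli k c * localPauli k a) * ρ)).trace := by
            rw [h2]
            simp only [smul_mul_assoc, trace_smul, smul_eq_mul, mul_assoc]
      _ = _ := by
            rw [trace_mul_comm, mul_assoc _ ρ S, hr, ← h1]
  have hc := neg_one_pow_val_mul_self (sympl c b)
  linear_combination (-1 : ℂ) ^ (sympl c b).val * h + (-1 : ℂ) ^ (sympl a b).val * X * hc

/-- Unbiasedness: for a true error `a`, the sign of the outcome `c` may be replaced by that of `a`,
after which the outcome probabilities sum to 1. -/
theorem sum_neg_one_pow_mul_trace_errorEffect (L : PauliChannel n)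
    {ρ : Matrix (Qubits n × Qubits k) (Qubits n × Qubits k) ℂ} (hρ : HasMixedAncilla ρ)
    {b : PauliLabel n} {Q : Matrix (Qubits k) (Qubits k) ℂ} (hl : pauliOp b ⊗ₖ Q * ρ = ρ)
    (hr : ρ * pauliOp b ⊗ₖ Q = ρ) :
    ∑ c, (-1 : ℂ) ^ (sympl c b).val * (errorEffect ρ c * applyLeft L.map ρ).trace =
      (L.eigenvalue b : ℂ) := by
  have h (a : PauliLabel n) : ∑ c, (-1 : ℂ) ^ (sympl c b).val *
      (errorEffect ρ c * (localPauli k a * ρ * localPauli k a)).trace =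
      (-1 : ℂ) ^ (sympl a b).val := by
    have h1 (c : PauliLabel n) : (-1 : ℂ) ^ (sympl c b).val *
        (errorEffect ρ c * (localPauli k a * ρ * localPauli k a)).trace =
        (-1 : ℂ) ^ (sympl a b).val *
          (errorEffect ρ c * (localPauli k a * ρ * localPauli k a)).trace := by
      rw [errorEffect, smul_mul_assoc, trace_smul, smul_eq_mul, mul_left_comm,
        neg_one_pow_sympl_mul_trace hl hr, mul_left_comm]
    simp_rw [h1]
    rw [← Finset.mul_sum, ← trace_sum, ← Finset.sum_mul, hρ.sum_errorEffect, one_mul,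
      trace_localPauli_conj, hρ.trace_eq_one, mul_one]
  simp only [applyLeft_map_eq_sum, Finset.mul_sum, trace_sum, mul_smul_comm, trace_smul,
    smul_eq_mul]
  rw [Finset.sum_comm]
  simp only [PauliChannel.eigenvalue, Complex.ofReal_sum, Complex.ofReal_mul, Complex.ofReal_pow,
    Complex.ofReal_neg, Complex.ofReal_one]
  refine Finset.sum_congr rfl fun a _ => ?_
  rw [← h a, Finset.mul_sum]
  exact Finset.sum_congr rfl fun c _ => by ring

end Probe

/-! ### Probe states from Bell pairs and stabilizer states -/

theorem pauliOp_append_apply {k m : ℕ} (b : PauliLabel (k + m)) (x c : Qubits (k + m)) :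
    pauliOp b x c =
      pauliOp (fun i => b (Fin.castAdd m i)) (fun i => x (Fin.castAdd m i))
        (fun i => c (Fin.castAdd m i)) *
      pauliOp (fun i => b (Fin.natAdd k i)) (fun i => x (Fin.natAdd k i))
        (fun i => c (Fin.natAdd k i)) := by
  simp only [pauliOp, tensorQubits, of_apply, Fin.prod_univ_add]

theorem sum_qubits_add {k m : ℕ} (f : Qubits k → Qubits m → ℂ) :
    ∑ x : Qubits (k + m), f (fun i => x (Fin.castAdd m i)) (fun i => x (Fin.natAdd k i)) =
      ∑ x, ∑ x', f x x' := by
  rw [← Fintype.sum_prod_type', ← (Fin.appendEquiv k m).sum_comp]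
  simp [Fin.appendEquiv]

/-- The amplitudes, up to normalization, of `k` Bell pairs, shared between the first `k` qubits and
the ancilla, times a state `φ` of the remaining `m` qubits. -/
def bellTensor {k m : ℕ} (φ : Qubits m → ℂ) : Qubits (k + m) × Qubits k → ℂ := fun p =>
  if (fun i => p.1 (Fin.castAdd m i)) = p.2 then φ (fun i => p.1 (Fin.natAdd k i)) else 0

/-- Bell pairs have the identity as amplitude matrix, and `P ⊗ Pᵀ` turns it into `P * P = 1`. The
factor `ω` on the ancilla compensates the eigenvalue on `φ`. -/
theorem kronecker_mulVec_bellTensor {k m : ℕ} {φ : Qubits m → ℂ} {b : PauliLabel (k + m)} {ω : ℂ}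
    (h : pauliOp (fun i => b (Fin.natAdd k i)) *ᵥ φ = ω • φ) (hω : ω * ω = 1) :
    (pauliOp b ⊗ₖ (ω • (pauliOp fun i => b (Fin.castAdd m i))ᵀ)) *ᵥ bellTensor φ =
      bellTensor φ := by
  ext ⟨x, y⟩
  set b₁ : PauliLabel k := fun i => b (Fin.castAdd m i)
  set b₂ : PauliLabel m := fun i => b (Fin.natAdd k i)
  set x₁ : Qubits k := fun i => x (Fin.castAdd m i) with hx₁
  set x₂ : Qubits m := fun i => x (Fin.natAdd k i) with hx₂
  have hsq := congrFun (congrFun (pauliOp_mul_self b₁) x₁) y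
  have h₂ := congrFun h x₂
  simp only [mulVec, dotProduct, Pi.smul_apply, smul_eq_mul] at h₂
  rw [mul_apply, one_apply] at hsq
  calc _ = ∑ c : Qubits (k + m), ω * (pauliOp b₁ x₁ (fun i => c (Fin.castAdd m i)) *
        pauliOp b₁ (fun i => c (Fin.castAdd m i)) y) *
        (pauliOp b₂ x₂ (fun i => c (Fin.natAdd k i)) * φ fun i => c (Fin.natAdd k i)) := by
        rw [mulVec, dotProduct, Fintype.sum_prod_type]
        refine Finset.sum_congr rfl fun c _ => ?_
        simp only [kronecker_apply, bellTensor, mul_ite, mul_zero, Finset.sum_ite_eq,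
          Finset.mem_univ, if_true, Matrix.smul_apply, transpose_apply, smul_eq_mul,
          pauliOp_append_apply b x c]
        ring
    _ = _ := by
        rw [sum_qubits_add fun c c' => ω * (pauliOp b₁ x₁ c * pauliOp b₁ c y) *
          (pauliOp b₂ x₂ c' * φ c')]
        simp only [← Finset.mul_sum, ← Finset.sum_mul]
        rw [hsq, h₂, bellTensor]
        by_cases hxy : x₁ = y
        · rw [if_pos hxy, if_pos hxy]
          linear_combination φ x₂ * hω
        · rw [if_neg hxy, if_neg hxy]
          ring

theorem eigenvalue_mul_self_of_pauliOp {m : ℕ} {φ : Qubits m → ℂ} {b : PauliLabel m} {ω : ℂ}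
    (hφ : φ ⬝ᵥ star φ = 1) (h : pauliOp b *ᵥ φ = ω • φ) : ω * ω = 1 := by
  have h1 : φ = (ω * ω) • φ := by
    calc φ = (pauliOp b * pauliOp b) *ᵥ φ := by rw [pauliOp_mul_self, one_mulVec]
      _ = _ := by rw [← mulVec_mulVec, h, mulVec_smul, h, smul_smul]
  have h2 := congrArg (· ⬝ᵥ star φ) h1
  simp only [smul_dotProduct, hφ, smul_eq_mul, mul_one] at h2
  exact h2.symm

/-- There are `2 ^ m + 1` states of `k + m` qubits and a `k`-qubit ancilla such that every Pauli
operator, completed by an operator on the ancilla, stabilizes one of them. -/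
theorem exists_probe_cover (k m : ℕ) :
    ∃ (S : Type) (_ : Fintype S)
      (ρ : S → Matrix (Qubits (k + m) × Qubits k) (Qubits (k + m) × Qubits k) ℂ),
      Fintype.card S = 2 ^ m + 1 ∧ (∀ s, (ρ s).PosSemidef) ∧ (∀ s, HasMixedAncilla (ρ s)) ∧
        ∀ b, ∃ s, ∃ Q : Matrix (Qubits k) (Qubits k) ℂ,
          pauliOp b ⊗ₖ Q * ρ s = ρ s ∧ ρ s * pauliOp b ⊗ₖ Q = ρ s := by
  obtain ⟨S, _, φ, hcard, hφ, hcover⟩ := exists_stabilizer_cover m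
  let ρ (s : S) : Matrix (Qubits (k + m) × Qubits k) (Qubits (k + m) × Qubits k) ℂ :=
    ((2 : ℂ) ^ k)⁻¹ • vecMulVec (bellTensor (φ s)) (star (bellTensor (φ s)))
  have hρ (s : S) : (ρ s).PosSemidef := by
    refine (posSemidef_vecMulVec_self_star _).smul ?_
    have h : (0 : ℝ) ≤ (2 ^ k)⁻¹ := by positivity
    have h' := Complex.zero_le_real.mpr h
    push_cast at h'
    exact h'
  refine ⟨S, inferInstance, ρ, hcard, hρ, fun s y y' => ?_, fun b => ?_⟩
  · have h := sum_qubits_add (k := k) fun x x' => ((2 : ℂ) ^ k)⁻¹ *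
      ((if x = y then φ s x' else 0) * star (if x = y' then φ s x' else 0))
    simp only [ρ, Matrix.smul_apply, vecMulVec_apply, bellTensor, Pi.star_apply, smul_eq_mul]
    rw [h]
    have hs : ∑ x, φ s x * star (φ s x) = 1 := hφ s
    by_cases hy : y = y'
    · subst hy
      rw [Finset.sum_eq_single y (fun x _ hx => by simp [hx]) (by simp)]
      simp only [if_true, ← Finset.mul_sum, hs, mul_one]
    · rw [if_neg hy]
      refine Finset.sum_eq_zero fun x _ => Finset.sum_eq_zero fun x' _ => ?_
      by_cases hx : x = y
      · rw [if_neg fun hx' => hy (hx.symm.trans hx'), star_zero, mul_zero, mul_zero]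
      · rw [if_neg hx, zero_mul, mul_zero]
  · obtain ⟨s, ω, h⟩ := hcover fun i => b (Fin.natAdd k i)
    have hω := eigenvalue_mul_self_of_pauliOp (hφ s) h
    have hl : pauliOp b ⊗ₖ (ω • (pauliOp fun i => b (Fin.castAdd m i))ᵀ) * ρ s = ρ s := by
      rw [mul_smul_comm, mul_vecMulVec, kronecker_mulVec_bellTensor h hω]
    refine ⟨s, _, hl, ?_⟩
    -- Since `ω = ±1`, the stabilizer is Hermitian, and taking adjoints turns the left identity into
    -- the right one.
    have hstar : star ω = ω := by
      rcases mul_self_eq_one_iff.mp hω with rfl | rfl <;> simp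
    have hherm : (pauliOp b ⊗ₖ (ω • (pauliOp fun i => b (Fin.castAdd m i))ᵀ)).IsHermitian := by
      rw [IsHermitian, conjTranspose_kronecker, (pauliOp_isHermitian b).eq, conjTranspose_smul,
        hstar, (pauliOp_isHermitian fun i => b (Fin.castAdd m i)).transpose.eq]
    have := congrArg conjTranspose hl
    rwa [conjTranspose_mul, hherm.eq, (hρ s).isHermitian.eq] at this

/-! ### Concentration of empirical means -/

open Finset in
/-- Chernoff bound for a sum of independent centred random variables with values in `[-2, 2]`. -/
theorem sum_prod_le_exp_of_centered {ι Ω : Type*} [Fintype ι] [DecidableEq ι] [Fintype Ω]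
    (p : ι → Ω → ℝ) (hp : ∀ i ω, 0 ≤ p i ω) (hsum : ∀ i, ∑ ω, p i ω = 1) (T : Finset ι)
    (h : Ω → ℝ) (hb : ∀ ω, |h ω| ≤ 2) (hmean : ∀ i ∈ T, ∑ ω, p i ω * h ω = 0)
    (ε : ℝ) (hε : 0 < ε) (hε1 : ε ≤ 1) :
    ∑ o : ι → Ω with T.card * ε < ∑ i ∈ T, h (o i), ∏ i, p i (o i) ≤
      Real.exp (-(T.card * ε ^ 2 / 16)) := by
  -- The minimizer of the exponent `-t * ε + 4 * t ^ 2`, with minimum `-ε ^ 2 / 16`. As `ε ≤ 1`, the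
  -- arguments `t * h ω` stay in the range where `exp y ≤ 1 + y + y ^ 2` is available.
  set t := ε / 8 with ht
  have hmgf (i : ι) (hi : i ∈ T) : ∑ ω, p i ω * Real.exp (t * h ω) ≤ Real.exp (4 * t ^ 2) := by
    have hpt (ω : Ω) : Real.exp (t * h ω) ≤ 1 + t * h ω + 4 * t ^ 2 := by
      have hth : |t * h ω| ≤ 2 * t := by
        rw [abs_mul, abs_of_pos (by positivity : 0 < t)]
        nlinarith [hb ω, (by positivity : 0 < t)]
      have h1 := (abs_le.mp (Real.abs_exp_sub_one_sub_id_le (hth.trans (by linarith)))).2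
      have h2 : (t * h ω) ^ 2 ≤ (2 * t) ^ 2 := sq_le_sq' (abs_le.mp hth).1 (abs_le.mp hth).2
      linarith
    calc ∑ ω, p i ω * Real.exp (t * h ω) ≤ ∑ ω, p i ω * (1 + t * h ω + 4 * t ^ 2) :=
          sum_le_sum fun ω _ => mul_le_mul_of_nonneg_left (hpt ω) (hp i ω)
      _ = ∑ ω, p i ω + t * ∑ ω, p i ω * h ω + 4 * t ^ 2 * ∑ ω, p i ω := by
          simp only [mul_sum, ← sum_add_distrib]
          exact sum_congr rfl fun ω _ => by ring
      _ ≤ _ := by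
          rw [hsum, hmean i hi]
          linarith [Real.add_one_le_exp (4 * t ^ 2)]
  calc ∑ o : ι → Ω with T.card * ε < ∑ i ∈ T, h (o i), ∏ i, p i (o i)
      ≤ ∑ o : ι → Ω with T.card * ε < ∑ i ∈ T, h (o i), Real.exp (-(t * (T.card * ε))) *
          ∏ i, p i (o i) * (if i ∈ T then Real.exp (t * h (o i)) else 1) := by
        refine sum_le_sum fun o ho => ?_
        rw [prod_mul_distrib, prod_ite_mem, univ_inter, ← Real.exp_sum, ← mul_sum,
          mul_left_comm, ← Real.exp_add]
        refine le_mul_of_one_le_right (prod_nonneg fun i _ => hp _ _) (Real.one_le_exp ?_)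
        nlinarith [(mem_filter.mp ho).2, (by positivity : 0 < t)]
    _ ≤ ∑ o : ι → Ω, Real.exp (-(t * (T.card * ε))) *
          ∏ i, p i (o i) * (if i ∈ T then Real.exp (t * h (o i)) else 1) := by
        refine sum_le_sum_of_subset_of_nonneg (filter_subset _ _) fun o _ _ =>
          mul_nonneg (Real.exp_pos _).le (prod_nonneg fun i _ => mul_nonneg (hp _ _) ?_)
        split_ifs <;> positivity
    _ = Real.exp (-(t * (T.card * ε))) *
          ∏ i, ∑ ω, p i ω * (if i ∈ T then Real.exp (t * h ω) else 1) := by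
        rw [← mul_sum, prod_univ_sum, Fintype.piFinset_univ]
    _ ≤ Real.exp (-(t * (T.card * ε))) * ∏ i, if i ∈ T then Real.exp (4 * t ^ 2) else 1 := by
        refine mul_le_mul_of_nonneg_left (prod_le_prod (fun i _ => sum_nonneg fun ω _ =>
          mul_nonneg (hp _ _) ?_) fun i _ => ?_) (Real.exp_pos _).le
        · split_ifs <;> positivity
        · split_ifs with hi
          · exact hmgf i hi
          · simp [hsum]
    _ = _ := by
        rw [prod_ite_mem, univ_inter, prod_const, ← Real.exp_nat_mul, ← Real.exp_add, ht]
        congr 1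
        ring

open Finset in
/-- Two-sided deviation of an empirical mean of independent variables with values in `[-1, 1]`. -/
theorem sum_prod_le_two_mul_exp {ι Ω : Type*} [Fintype ι] [DecidableEq ι] [Fintype Ω]
    (p : ι → Ω → ℝ) (hp : ∀ i ω, 0 ≤ p i ω) (hsum : ∀ i, ∑ ω, p i ω = 1) (T : Finset ι)
    (hT : T.Nonempty) (g : Ω → ℝ) (hg : ∀ ω, |g ω| ≤ 1) (μ : ℝ)
    (hmean : ∀ i ∈ T, ∑ ω, p i ω * g ω = μ) (ε : ℝ) (hε : 0 < ε) (hε1 : ε ≤ 1) :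
    ∑ o : ι → Ω with ε < |(∑ i ∈ T, g (o i)) / T.card - μ|, ∏ i, p i (o i) ≤
      2 * Real.exp (-(T.card * ε ^ 2 / 16)) := by
  have hμ : |μ| ≤ 1 := by
    obtain ⟨i, hi⟩ := hT
    rw [← hmean i hi, ← hsum i]
    refine (abs_sum_le_sum_abs _ _).trans (sum_le_sum fun ω _ => ?_)
    rw [abs_mul, abs_of_nonneg (hp i ω)]
    exact mul_le_of_le_one_right (hp i ω) (hg ω)
  have hupper := sum_prod_le_exp_of_centered p hp hsum T (fun ω => g ω - μ)
    (fun ω => by linarith [abs_sub (g ω) μ, hg ω])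
    (fun i hi => by
      simp only [mul_sub, sum_sub_distrib, ← sum_mul, hmean i hi, hsum, one_mul, sub_self])
    ε hε hε1
  have hlower := sum_prod_le_exp_of_centered p hp hsum T (fun ω => μ - g ω)
    (fun ω => by linarith [abs_sub μ (g ω), hg ω])
    (fun i hi => by
      simp only [mul_sub, sum_sub_distrib, ← sum_mul, hmean i hi, hsum, one_mul, sub_self])
    ε hε hε1
  have hcard : (0 : ℝ) < T.card := by exact_mod_cast hT.card_pos
  rw [two_mul]
  refine le_trans ?_ (add_le_add hupper hlower)
  classical
  rw [← sum_union_inter]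
  have hnn (o : ι → Ω) : 0 ≤ ∏ i, p i (o i) := prod_nonneg fun i _ => hp _ _
  refine (sum_le_sum_of_subset_of_nonneg (fun o ho => ?_) fun o _ _ => hnn o).trans
    (le_add_of_nonneg_right (sum_nonneg fun o _ => hnn o))
  simp only [mem_union, mem_filter, mem_univ, true_and, sum_sub_distrib, sum_const,
    nsmul_eq_mul] at ho ⊢
  have hmul : (T.card : ℝ) * ((∑ i ∈ T, g (o i)) / T.card - μ) =
      ∑ i ∈ T, g (o i) - T.card * μ := by
    field_simp
  rcases lt_abs.mp ho with h | h
  · left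
    linarith [mul_lt_mul_of_pos_left h hcard]
  · right
    linarith [mul_lt_mul_of_pos_left h hcard]

/-! ### The protocol and its success probability -/

/-- The protocol that measures the Pauli error on the probe states `ρ i`. -/
noncomputable def errorProtocol {n k N : ℕ}
    (ρ : Fin N → Matrix (Qubits n × Qubits k) (Qubits n × Qubits k) ℂ)
    (hρ : ∀ i, (ρ i).PosSemidef) (hmix : ∀ i, HasMixedAncilla (ρ i))
    (estimate : (Fin N → PauliLabel n) → PauliLabel n → ℝ) : AncillaProtocol n k N where
  state := ρ
  state_posSemidef := hρ
  state_trace i := (hmix i).trace_eq_one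
  Outcome _ := PauliLabel n
  outcomeFintype _ := inferInstance
  effect i := errorEffect (ρ i)
  effect_posSemidef i := errorEffect_posSemidef (hρ i)
  effect_sum i := (hmix i).sum_errorEffect
  estimate := estimate

/-- Union bound for the failure of one of finitely many requirements. -/
theorem one_sub_le_sum_filter_forall {Ω B : Type*} [Fintype Ω] [Fintype B] (w : Ω → ℝ)
    (hw : ∀ o, 0 ≤ w o) (hsum : ∑ o, w o = 1) (good : Ω → B → Prop)
    [∀ o b, Decidable (good o b)] [DecidablePred fun o => ∀ b, good o b] (η : ℝ)
    (h : ∀ b, ∑ o with ¬ good o b, w o ≤ η) :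
    1 - Fintype.card B * η ≤ ∑ o with ∀ b, good o b, w o := by
  classical
  have hbad : ∑ o with ¬ ∀ b, good o b, w o ≤ ∑ b, ∑ o with ¬ good o b, w o := by
    simp only [Finset.sum_filter]
    rw [Finset.sum_comm]
    refine Finset.sum_le_sum fun o _ => ?_
    have hnn (b : B) : 0 ≤ if ¬ good o b then w o else 0 := by
      split_ifs
      exacts [le_rfl, hw o]
    split_ifs with h0
    · exact Finset.sum_nonneg fun b _ => hnn b
    · obtain ⟨b, hb⟩ := not_forall.mp h0
      exact (if_pos hb).ge.trans
        (Finset.single_le_sum (fun b _ => hnn b) (Finset.mem_univ b))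
  have hle : ∑ b, ∑ o with ¬ good o b, w o ≤ Fintype.card B * η := by
    simpa using Finset.sum_le_sum fun b (_ : b ∈ Finset.univ) => h b
  have hsplit := Finset.sum_filter_add_sum_filter_not Finset.univ (fun o => ∀ b, good o b) w
  linarith

theorem abs_neg_one_pow_le_one (j : ℕ) : |(-1 : ℝ) ^ j| ≤ 1 := by
  rw [abs_pow, abs_neg, abs_one, one_pow]

/-- With `M` samples of each of `2 ^ m + 1` probe states, all eigenvalues are estimated up to
`ε`, except with an exponentially small probability. -/
theorem exists_protocol_successProb (k m M : ℕ) (hM : 0 < M) (ε : ℝ) (hε : 0 < ε) (hε1 : ε ≤ 1) :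
    ∃ P : AncillaProtocol (k + m) k ((2 ^ m + 1) * M), ∀ L : PauliChannel (k + m),
      1 - 4 ^ (k + m) * (2 * Real.exp (-(M * ε ^ 2 / 16))) ≤ P.successProb L ε := by
  classical
  obtain ⟨S, _, ρ, hcard, hρ, hmix, hcover⟩ := exists_probe_cover k m
  choose probe hprobe using hcover
  let e : Fin ((2 ^ m + 1) * M) ≃ S × Fin M :=
    (Fintype.equivFinOfCardEq (by simp [hcard])).symm
  -- The samples used for `λ_b`. Different labels may share samples, since the union bound needs no
  -- independence between labels.
  let T (b : PauliLabel (k + m)) : Finset (Fin ((2 ^ m + 1) * M)) :=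
    Finset.univ.filter fun i => (e i).1 = probe b
  have hT (b : PauliLabel (k + m)) : (T b).card = M := by
    have : (T b).map e.toEmbedding = {probe b} ×ˢ Finset.univ := by
      ext ⟨s, j⟩
      simp [T, eq_comm]
    rw [← Finset.card_map e.toEmbedding, this]
    simp
  refine ⟨errorProtocol (fun i => ρ (e i).1) (fun i => hρ _) (fun i => hmix _)
    fun o b => (∑ i ∈ T b, (-1 : ℝ) ^ (sympl (o i) b).val) / (T b).card, fun L => ?_⟩
  let p (i : Fin ((2 ^ m + 1) * M)) (c : PauliLabel (k + m)) : ℝ :=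
    (errorEffect (ρ (e i).1) c * applyLeft L.map (ρ (e i).1)).trace.re
  have hp (i) (c) : 0 ≤ p i c :=
    (Complex.nonneg_iff.mp (trace_mul_nonneg_of_posSemidef (errorEffect_posSemidef (hρ _) c)
      (applyLeft_map_posSemidef L (hρ _)))).1
  have hsum (i) : ∑ c, p i c = 1 := by
    simp only [p, ← Complex.re_sum, ← trace_sum, ← Finset.sum_mul, (hmix _).sum_errorEffect,
      one_mul, trace_applyLeft_map, (hmix _).trace_eq_one, Complex.one_re]
  have hmean (b : PauliLabel (k + m)) (i) (hi : i ∈ T b) :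
      ∑ c, p i c * (-1 : ℝ) ^ (sympl c b).val = L.eigenvalue b := by
    obtain ⟨Q, hl, hr⟩ := hprobe b
    rw [← (Finset.mem_filter.mp hi).2] at hl hr
    have h := congrArg Complex.re (sum_neg_one_pow_mul_trace_errorEffect L (hmix _) hl hr)
    rw [Complex.re_sum, Complex.ofReal_re] at h
    rw [← h]
    refine Finset.sum_congr rfl fun c _ => ?_
    have hc : ((-1 : ℂ) ^ (sympl c b).val) = (((-1 : ℝ) ^ (sympl c b).val : ℝ) : ℂ) := by
      push_cast; rfl
    rw [hc, Complex.re_ofReal_mul, mul_comm]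
  have hprod : ∑ o : Fin ((2 ^ m + 1) * M) → PauliLabel (k + m), ∏ i, p i (o i) = 1 := by
    rw [← Fintype.piFinset_univ, ← Finset.prod_univ_sum]
    simp [hsum]
  have hcardP : (Fintype.card (PauliLabel (k + m)) : ℝ) = 4 ^ (k + m) := by
    simp
  rw [← hcardP]
  refine one_sub_le_sum_filter_forall
    (fun o : Fin ((2 ^ m + 1) * M) → PauliLabel (k + m) => ∏ i, p i (o i))
    (fun o => Finset.prod_nonneg fun i _ => hp i _) hprod
    (fun o b => |(∑ i ∈ T b, (-1 : ℝ) ^ (sympl (o i) b).val) / (T b).card - L.eigenvalue b| ≤ ε)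
    _ fun b => ?_
  simp only [not_le]
  have h := sum_prod_le_two_mul_exp p hp hsum (T b) (Finset.card_pos.mp (by rwa [hT]))
    (fun c => (-1 : ℝ) ^ (sympl c b).val) (fun c => abs_neg_one_pow_le_one _) (L.eigenvalue b)
    (hmean b) ε hε hε1
  rwa [hT b] at h ⊢

/-! ### Trivial regimes, the number of samples and the conclusion -/

theorem PauliChannel.abs_eigenvalue_le_one {n : ℕ} (L : PauliChannel n) (b : PauliLabel n) :
    |L.eigenvalue b| ≤ 1 := by
  rw [PauliChannel.eigenvalue]
  refine (Finset.abs_sum_le_sum_abs _ _).trans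
    ((Finset.sum_le_sum fun a _ => ?_).trans L.rates_sum.le)
  rw [abs_mul, abs_of_nonneg (L.rates_nonneg a)]
  exact mul_le_of_le_one_right (L.rates_nonneg a) (abs_neg_one_pow_le_one _)

theorem PauliChannel.eigenvalue_of_zero_qubits (L : PauliChannel 0) (b : PauliLabel 0) :
    L.eigenvalue b = 1 := by
  have h := L.rates_sum
  simp only [PauliChannel.eigenvalue, sympl, Finset.univ_eq_empty, Finset.sum_empty, ZMod.val_zero,
    pow_zero, mul_one, h]

/-- The protocol without samples, whose estimates do not depend on the channel. -/
noncomputable def constProtocol (n k : ℕ) (estimate : PauliLabel n → ℝ) :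
    AncillaProtocol n k 0 where
  state i := i.elim0
  state_posSemidef i := i.elim0
  state_trace i := i.elim0
  Outcome _ := Unit
  outcomeFintype _ := inferInstance
  effect i := i.elim0
  effect_posSemidef i := i.elim0
  effect_sum i := i.elim0
  estimate _ := estimate

theorem constProtocol_successProb {n k : ℕ} {estimate : PauliLabel n → ℝ} {L : PauliChannel n}
    {ε : ℝ} (h : ∀ a, |estimate a - L.eigenvalue a| ≤ ε) :
    (constProtocol n k estimate).successProb L ε = 1 := by
  have h' (o) (a) : |(constProtocol n k estimate).estimate o a - L.eigenvalue a| ≤ ε := h a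
  rw [AncillaProtocol.successProb, Finset.filter_true_of_mem fun o _ => h' o]
  simp only [Finset.univ_eq_empty, Finset.prod_empty, Finset.sum_const, Finset.card_univ,
    nsmul_eq_mul, mul_one, Fintype.card_pi, Nat.cast_one]

/-- A number of repetitions that brings the failure probability below `δ`. -/
theorem exists_repetitions (l n : ℕ) (hn : 1 ≤ n) (ε δ δ₀ : ℝ) (hε : 0 < ε) (hε1 : ε ≤ 1)
    (hδ : 0 < δ) (hδ₀ : δ ≤ δ₀) (hδ₁ : δ₀ < 1) :
    ∃ M : ℕ, 0 < M ∧ 4 ^ n * (2 * Real.exp (-(M * ε ^ 2 / 16))) ≤ δ ∧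
      (((2 ^ l + 1) * M : ℕ) : ℝ) ≤ 2 * (16 + 49 / Real.log δ₀⁻¹) *
        (n * 2 ^ l * (ε⁻¹) ^ 2 * Real.log δ⁻¹) := by
  set ℓ := Real.log δ⁻¹ with hℓ
  set ℓ₀ := Real.log δ₀⁻¹ with hℓ₀
  have hpos₀ : 0 < ℓ₀ := Real.log_pos ((one_lt_inv₀ (hδ.trans_le hδ₀)).mpr hδ₁)
  have hle : ℓ₀ ≤ ℓ := Real.log_le_log (inv_pos.mpr (hδ.trans_le hδ₀)) (inv_anti₀ hδ hδ₀)
  have hn' : (1 : ℝ) ≤ n := by exact_mod_cast hn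
  have hε2 : (1 : ℝ) ≤ (ε⁻¹) ^ 2 := one_le_pow₀ ((one_le_inv₀ hε).mpr hε1)
  have hr : 1 ≤ ℓ / ℓ₀ := (one_le_div hpos₀).mpr hle
  have hlog2 : Real.log 2 ≤ 1 := by linarith [Real.log_two_lt_d9]
  have hlog2' : 0 ≤ Real.log 2 := Real.log_nonneg one_le_two
  -- The term `3 * n` pays for the union bound, as `4 ^ n * 2 ≤ exp (3 * n)` for `n ≥ 1`; `ℓ` yields
  -- the factor `δ`.
  set x := 16 * (ε⁻¹) ^ 2 * (3 * n + ℓ) with hx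
  have hxpos : 0 < x := by
    have : 0 < ℓ := hpos₀.trans_le hle
    positivity
  refine ⟨⌈x⌉₊, Nat.ceil_pos.mpr hxpos, ?_, ?_⟩
  · have h1 : 3 * n + ℓ ≤ ⌈x⌉₊ * ε ^ 2 / 16 := by
      have h2 : x * ε ^ 2 / 16 = 3 * n + ℓ := by
        rw [hx]; field_simp
      have h3 := Nat.le_ceil x
      rw [← h2]
      gcongr
    have h4 : (4 : ℝ) ^ n * 2 ≤ Real.exp (3 * n) := by
      have h5 : (4 : ℝ) ^ n * 2 = Real.exp ((2 * n + 1) * Real.log 2) := by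
        rw [add_mul, Real.exp_add, one_mul, Real.exp_log two_pos, mul_assoc, mul_left_comm,
          Real.exp_nat_mul, two_mul, Real.exp_add, Real.exp_log two_pos]
        norm_num
      rw [h5]
      refine Real.exp_le_exp.mpr ?_
      nlinarith
    calc 4 ^ n * (2 * Real.exp (-(⌈x⌉₊ * ε ^ 2 / 16)))
        ≤ Real.exp (3 * n) * Real.exp (-(3 * n + ℓ)) := by
          rw [← mul_assoc]
          gcongr
      _ = δ := by
          rw [← Real.exp_add, show (3 * n + -(3 * n + ℓ) : ℝ) = -ℓ by ring, hℓ, Real.log_inv,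
            neg_neg, Real.exp_log hδ]
  · have h1 : (⌈x⌉₊ : ℝ) ≤ x + 1 := (Nat.ceil_lt_add_one hxpos.le).le
    have h2 : (2 : ℝ) ^ l + 1 ≤ 2 * 2 ^ l := by linarith [one_le_pow₀ (n := l) (one_le_two (α := ℝ))]
    have hn0 : (0 : ℝ) < n := by linarith
    have hℓpos : 0 < ℓ := hpos₀.trans_le hle
    -- The constant 49 is `16 * 3` from the union bound plus 1 from rounding up; both are scaled by
    -- `ℓ / ℓ₀ ≥ 1`.
    have h3 : x + 1 ≤ (16 + 49 / ℓ₀) * (n * (ε⁻¹) ^ 2 * ℓ) := by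
      have h4 : (16 + 49 / ℓ₀) * (n * (ε⁻¹) ^ 2 * ℓ) =
          16 * (ε⁻¹) ^ 2 * (3 * n * (ℓ / ℓ₀) + n * ℓ) + (ε⁻¹) ^ 2 * (n * (ℓ / ℓ₀)) := by
        ring
      rw [h4]
      have h5 : 3 * n + ℓ ≤ 3 * n * (ℓ / ℓ₀) + n * ℓ := by
        have := le_mul_of_one_le_right (by positivity : (0 : ℝ) ≤ 3 * n) hr
        have := le_mul_of_one_le_left hℓpos.le hn'
        linarith
      have h6 : (1 : ℝ) ≤ (ε⁻¹) ^ 2 * (n * (ℓ / ℓ₀)) :=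
        one_le_mul_of_one_le_of_one_le hε2 (one_le_mul_of_one_le_of_one_le hn' hr)
      rw [hx]
      gcongr
    push_cast
    calc ((2 : ℝ) ^ l + 1) * ⌈x⌉₊ ≤ 2 * 2 ^ l * ((16 + 49 / ℓ₀) * (n * (ε⁻¹) ^ 2 * ℓ)) :=
          mul_le_mul h2 (h1.trans h3) (Nat.cast_nonneg _) (by positivity)
      _ = _ := by ring

theorem corollary1 (δ₀ : ℝ) (hδ₀ : δ₀ < 1) :
    ∃ C : ℝ, 0 < C ∧ ∀ (n k : ℕ), k ≤ n → ∀ (ε δ : ℝ), 0 < ε → 0 < δ → δ ≤ δ₀ →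
      ∃ N : ℕ, (N : ℝ) ≤ C * (n * 2 ^ (n - k) * (ε⁻¹) ^ 2 * Real.log δ⁻¹) ∧
        ∃ P : AncillaProtocol n k N, ∀ L : PauliChannel n, 1 - δ ≤ P.successProb L ε := by
  rcases le_or_gt δ₀ 0 with hδ₀' | hδ₀'
  · exact ⟨1, one_pos, fun n k _ ε δ _ hδ hle => absurd (hδ.trans_le hle) hδ₀'.not_gt⟩
  have hlog : 0 < Real.log δ₀⁻¹ := Real.log_pos ((one_lt_inv₀ hδ₀').mpr hδ₀)
  refine ⟨2 * (16 + 49 / Real.log δ₀⁻¹), by positivity, fun n k hk ε δ hε hδ hle => ?_⟩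
  have hlogδ : 0 ≤ Real.log δ⁻¹ :=
    Real.log_nonneg ((one_le_inv₀ hδ).mpr (hle.trans hδ₀.le))
  -- For `n = 0` or large `ε` the bound on `N` can be below 1, so no sample is allowed there. A
  -- constant estimate then suffices: 1 when `n = 0`, and 0 when `ε > 1`.
  by_cases htrivial : ∃ c : ℝ, ∀ (L : PauliChannel n) (a), |c - L.eigenvalue a| ≤ ε
  · obtain ⟨c, hc⟩ := htrivial
    refine ⟨0, by rw [Nat.cast_zero]; positivity, constProtocol n k fun _ => c, fun L => ?_⟩
    rw [constProtocol_successProb (hc L)]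
    linarith
  have hε1 : ε ≤ 1 := by
    by_contra! h
    exact htrivial ⟨0, fun L a => by
      rw [zero_sub, abs_neg]; exact (L.abs_eigenvalue_le_one a).trans h.le⟩
  have hn : 1 ≤ n := by
    rw [Nat.one_le_iff_ne_zero]
    rintro rfl
    exact htrivial ⟨1, fun L a => by
      rw [L.eigenvalue_of_zero_qubits, sub_self, abs_zero]; exact hε.le⟩
  obtain ⟨m, rfl⟩ := Nat.exists_eq_add_of_le hk
  obtain ⟨M, hM, hfail, hN⟩ := exists_repetitions m (k + m) hn ε δ δ₀ hε hε1 hδ hle hδ₀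
  obtain ⟨P, hP⟩ := exists_protocol_successProb k m M hM ε hε hε1
  rw [Nat.add_sub_cancel_left]
  exact ⟨_, hN, P, fun L => (sub_le_sub_left hfail 1).trans (hP L)⟩
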